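/- Let $X$ be a $\mathrm{CAT}(1)$ metric space, i.e. a metric space in which any two points at distance less than $\pi$ are joined by a geodesic, and in which, for every geodesic triangle of perimeter less than $2\pi$, the distance between any two points of the triangle is at most the distance between the corresponding points of the comparison triangle (the triangle with the same side lengths) on the unit sphere $S^2$ with its angular metric. Let $c:[a,b]\to X$, $c(a)=c(b)$, be a continuous closed curve with image $C$ and length $\ell<2\pi$. Then $C$ is contained in a closed ball of radius at most $\ell/4<\pi/2$. More precisely, call parameters $s\le t$ in $[a,b]$ antipodal if the arc $c|_{[s,t]}$ has length $\ell/2$. Then $a$ is antipodal to some parameter $t \geq a$; every parameter in $[a,b]$ is antipodal to some parameter; and whenever $s\le t$ are antipodal, there is a unique geodesic from $c(s)$ to $c(t)$, and $C$ is contained in the closed ball of radius $\ell/4$ centred at its midpoint. -/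

import Mathlib

/-- `γ`, restricted to `[0, dist x y]`, is a (minimal, unit speed) geodesic from `x` to `y`. -/
def IsGeodesicPath {X : Type*} [MetricSpace X] (γ : ℝ → X) (x y : X) : Prop :=
  γ 0 = x ∧ γ (dist x y) = y ∧
    ∀ s ∈ Set.Icc 0 (dist x y), ∀ t ∈ Set.Icc 0 (dist x y), dist (γ s) (γ t) = |s - t|

/-- The model space: the unit sphere in `ℝ³`. -/
abbrev UnitSphereTwo : Type := Metric.sphere (0 : EuclideanSpace ℝ (Fin 3)) 1

/-- The intrinsic (angular) distance on the unit sphere. -/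
noncomputable def sphericalDist (u v : UnitSphereTwo) : ℝ :=
  InnerProductGeometry.angle (u : EuclideanSpace ℝ (Fin 3)) (v : EuclideanSpace ℝ (Fin 3))

/-- A geodesic triangle (possibly degenerate): three vertices, indexed cyclically, and
for each `i` a chosen geodesic `side i` from `vertex i` to `vertex (i + 1)`. -/
structure GeodesicTriangle (X : Type*) [MetricSpace X] where
  vertex : Fin 3 → X
  side : Fin 3 → ℝ → X
  isGeodesicPath_side : ∀ i, IsGeodesicPath (side i) (vertex i) (vertex (i + 1))

namespace GeodesicTriangle

/-- The length of the `i`-th side. -/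
noncomputable def sideLength {X : Type*} [MetricSpace X] (T : GeodesicTriangle X)
    (i : Fin 3) : ℝ :=
  dist (T.vertex i) (T.vertex (i + 1))

/-- The perimeter of a geodesic triangle. -/
noncomputable def perimeter {X : Type*} [MetricSpace X] (T : GeodesicTriangle X) : ℝ :=
  ∑ i, T.sideLength i

/-- `v` are the vertices of a comparison triangle for `T` on the unit sphere. -/
def IsComparisonTriangle {X : Type*} [MetricSpace X] (T : GeodesicTriangle X)
    (v : Fin 3 → UnitSphereTwo) : Prop :=
  ∀ i, sphericalDist (v i) (v (i + 1)) = T.sideLength i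

/-- `z` is the comparison point, on the side from `v i` to `v (i + 1)` of the comparison
triangle, of the point `T.side i s`. -/
def IsComparisonPoint {X : Type*} [MetricSpace X] (T : GeodesicTriangle X)
    (v : Fin 3 → UnitSphereTwo) (i : Fin 3) (s : ℝ) (z : UnitSphereTwo) : Prop :=
  sphericalDist (v i) z = s ∧ sphericalDist z (v (i + 1)) = T.sideLength i - s

/-- The comparison inequality for `T`: distances between points of the triangle are at most
the distances between their comparison points on the unit sphere. -/
def SatisfiesCATOne {X : Type*} [MetricSpace X] (T : GeodesicTriangle X) : Prop :=
  ∀ v : Fin 3 → UnitSphereTwo, T.IsComparisonTriangle v →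
    ∀ i j : Fin 3, ∀ s ∈ Set.Icc 0 (T.sideLength i), ∀ t ∈ Set.Icc 0 (T.sideLength j),
      ∀ z w : UnitSphereTwo, T.IsComparisonPoint v i s z → T.IsComparisonPoint v j t w →
        dist (T.side i s) (T.side j t) ≤ sphericalDist z w

end GeodesicTriangle

/-- A `CAT(1)` metric space: points at distance less than `π` are joined by a geodesic, and
every geodesic triangle of perimeter less than `2π` satisfies the comparison inequality. -/
structure IsCATOne (X : Type*) [MetricSpace X] : Prop where
  exists_geodesic : ∀ x y : X, dist x y < Real.pi → ∃ γ : ℝ → X, IsGeodesicPath γ x y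
  comparison : ∀ T : GeodesicTriangle X, T.perimeter < 2 * Real.pi → T.SatisfiesCATOne

/-- The length of the curve `c` restricted to `[s, t]`: the supremum of the lengths of
inscribed polygons. -/
noncomputable def curveLength {X : Type*} [MetricSpace X] (c : ℝ → X) (s t : ℝ) : ENNReal :=
  eVariationOn c (Set.Icc s t)

/-- `c` is a closed curve, parametrized by `[a, b]`. -/
def IsClosedCurve {X : Type*} [MetricSpace X] (c : ℝ → X) (a b : ℝ) : Prop :=
  a ≤ b ∧ ContinuousOn c (Set.Icc a b) ∧ c a = c b

/-- The parameters `s ≤ t` are antipodal on the curve `c` over `[a, b]`: the arc between them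
has half the total length. -/
def IsAntipodalPair {X : Type*} [MetricSpace X] (c : ℝ → X) (a b s t : ℝ) : Prop :=
  a ≤ s ∧ s ≤ t ∧ t ≤ b ∧ 2 * curveLength c s t = curveLength c a b

/-!
Let `p = c s` and `q = c t` be antipodal and put `L = ℓ / 2 < π`.  The curve consists of two arcs
of length `L` joining `p` and `q`, so every point `x` on it satisfies
`dist p x + dist q x ≤ L`, and `dist p q ≤ L < π` (`dist_add_dist_le_of_isAntipodalPair`).

The centre is found by comparison with the sphere.  Let `α`, `β` and `d` be the lengths of the
sides `px`, `qx` and `pq`; the perimeter of the triangle is at most `2 * L < 2 * π`, and a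
comparison triangle exists (`exists_sphere_triangle`).  The midpoint `m` of the side `pq` of the
comparison triangle is `(p + q) / (2 cos (d / 2))`, whence
`⟪x, m⟫ = (cos α + cos β) / (2 cos (d / 2))
  = cos ((α + β) / 2) cos ((α - β) / 2) / cos (d / 2) ≥ cos ((α + β) / 2)`,
because `|α - β| ≤ d`.  So the angle between `x` and `m` is at most `(α + β) / 2 ≤ ℓ / 4`
(`IsCATOne.dist_midpoint_le`).  Two geodesics from `p` to `q` form a degenerate triangle with
vertices `p, q, q`, in which points with the same parameter have the same comparison point; this
gives uniqueness (`IsCATOne.geodesic_unique`).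

Antipodal parameters exist by the intermediate value theorem, because the length of the initial
arcs of a continuous rectifiable curve depends continuously on the endpoint
(`continuousOn_variationOnFromTo`).
-/

open Set

/-! ### Points on the unit sphere -/

/-- The point of the unit sphere with coordinates `x`, `y`, `z`. -/
noncomputable def spherePoint (x y z : ℝ) (h : x ^ 2 + y ^ 2 + z ^ 2 = 1) : UnitSphereTwo :=
  ⟨!₂[x, y, z], by
    rw [mem_sphere_zero_iff_norm, EuclideanSpace.norm_eq]
    simp [Fin.sum_univ_three, h]⟩

lemma sphericalDist_spherePoint {x y z x' y' z' : ℝ} (h : x ^ 2 + y ^ 2 + z ^ 2 = 1)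
    (h' : x' ^ 2 + y' ^ 2 + z' ^ 2 = 1) :
    sphericalDist (spherePoint x y z h) (spherePoint x' y' z' h') =
      Real.arccos (x * x' + y * y' + z * z') := by
  have e (u : UnitSphereTwo) : ‖(u : EuclideanSpace ℝ (Fin 3))‖ = 1 := by
    simp
  rw [sphericalDist, InnerProductGeometry.angle, e, e]
  simp [spherePoint, PiLp.inner_apply, Fin.sum_univ_three, mul_comm]

lemma sphericalDist_self (u : UnitSphereTwo) : sphericalDist u u = 0 := by
  refine InnerProductGeometry.angle_self fun h => ?_
  have := u.2
  simp [h] at this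

lemma sphericalDist_comm (u v : UnitSphereTwo) : sphericalDist u v = sphericalDist v u :=
  InnerProductGeometry.angle_comm _ _

/-- The point at angle `θ` on the equator. -/
noncomputable def equatorPoint (θ : ℝ) : UnitSphereTwo :=
  spherePoint (Real.cos θ) (Real.sin θ) 0 (by nlinarith [Real.sin_sq_add_cos_sq θ])

lemma sphericalDist_equatorPoint {θ φ : ℝ} (h : θ ≤ φ) (h' : φ - θ ≤ Real.pi) :
    sphericalDist (equatorPoint θ) (equatorPoint φ) = φ - θ := by
  rw [equatorPoint, equatorPoint, sphericalDist_spherePoint, ← Real.arccos_cos (sub_nonneg.2 h) h',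
    Real.cos_sub]
  ring_nf

/-- A spherical triangle with sides `d`, `α`, `β` exists under the triangle inequalities and the
bound `2 * π` on the perimeter. Its first two vertices are `equatorPoint 0` and `equatorPoint d`,
and the distance from the third one to the midpoint `equatorPoint (d / 2)` is at most the mean of
`α` and `β`. -/
lemma exists_sphere_triangle {d α β : ℝ} (hd : d < Real.pi) (hα : 0 ≤ α) (hβ : 0 ≤ β)
    (h₁ : d ≤ α + β) (h₂ : α ≤ d + β) (h₃ : β ≤ d + α) (h₄ : α + β ≤ Real.pi) :
    ∃ x : UnitSphereTwo, sphericalDist (equatorPoint 0) x = α ∧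
      sphericalDist (equatorPoint d) x = β ∧
      sphericalDist (equatorPoint (d / 2)) x ≤ (α + β) / 2 := by
  have hd₀ : 0 ≤ d := by linarith
  have hsα : 0 ≤ Real.sin α := Real.sin_nonneg_of_nonneg_of_le_pi hα (by linarith)
  -- The second coordinate `u` of `x` is forced by the distance to `equatorPoint d`.
  obtain ⟨u, hu, hu'⟩ : ∃ u, Real.cos d * Real.cos α + Real.sin d * u = Real.cos β ∧
      |u| ≤ Real.sin α := by
    rcases hd₀.eq_or_lt with rfl | hd₀
    · refine ⟨0, ?_, by simpa using hsα⟩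
      rw [show α = β by linarith]
      simp
    · have hs : 0 < Real.sin d := Real.sin_pos_of_pos_of_lt_pi hd₀ hd
      refine ⟨(Real.cos β - Real.cos d * Real.cos α) / Real.sin d, by field_simp; ring, ?_⟩
      have hlow : Real.cos β ≤ Real.cos (d - α) := by
        rw [← Real.cos_abs (d - α)]
        exact Real.cos_le_cos_of_nonneg_of_le_pi (abs_nonneg _) (by linarith)
          (abs_le.2 ⟨by linarith, by linarith⟩)
      have hupp : Real.cos (d + α) ≤ Real.cos β := by
        rcases le_total (d + α) Real.pi with h | h
        · exact Real.cos_le_cos_of_nonneg_of_le_pi hβ h h₃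
        · rw [← Real.cos_two_pi_sub (d + α)]
          exact Real.cos_le_cos_of_nonneg_of_le_pi hβ (by linarith) (by linarith)
      rw [Real.cos_sub] at hlow
      rw [Real.cos_add] at hupp
      rw [abs_div, abs_of_pos hs, div_le_iff₀ hs, abs_le]
      constructor <;> linarith
  have hu2 : u ^ 2 ≤ Real.sin α ^ 2 := sq_le_sq' (abs_le.1 hu').1 (abs_le.1 hu').2
  have hx : Real.cos α ^ 2 + u ^ 2 + Real.sqrt (Real.sin α ^ 2 - u ^ 2) ^ 2 = 1 := by
    rw [Real.sq_sqrt (by linarith)]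
    linarith [Real.sin_sq_add_cos_sq α]
  refine ⟨spherePoint _ _ _ hx, ?_, ?_, ?_⟩
  · rw [equatorPoint, sphericalDist_spherePoint]
    simpa using Real.arccos_cos hα (by linarith)
  · rw [equatorPoint, sphericalDist_spherePoint, ← Real.arccos_cos hβ (by linarith), ← hu]
    simp
  · rw [equatorPoint, sphericalDist_spherePoint,
      ← Real.arccos_cos (x := (α + β) / 2) (by linarith) (by linarith [Real.pi_pos])]
    refine Real.arccos_le_arccos ?_
    have hc : 0 < Real.cos (d / 2) :=
      Real.cos_pos_of_mem_Ioo ⟨by linarith, by linarith⟩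
    have hc' : 0 ≤ Real.cos ((α + β) / 2) :=
      Real.cos_nonneg_of_mem_Icc ⟨by linarith, by linarith⟩
    have hle : Real.cos (d / 2) ≤ Real.cos ((α - β) / 2) := by
      rw [← Real.cos_abs ((α - β) / 2)]
      exact Real.cos_le_cos_of_nonneg_of_le_pi (abs_nonneg _) (by linarith)
        (abs_le.2 ⟨by linarith, by linarith⟩)
    have hd2 : d = 2 * (d / 2) := by ring
    rw [hd2, Real.cos_two_mul, Real.sin_two_mul] at hu
    have hsum := Real.cos_add_cos α β
    have key : (Real.cos (d / 2) * Real.cos α + Real.sin (d / 2) * u) * Real.cos (d / 2) =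
        Real.cos ((α + β) / 2) * Real.cos ((α - β) / 2) := by linarith
    have := mul_le_mul_of_nonneg_left hle hc'
    rw [← key] at this
    have := le_of_mul_le_mul_right this hc
    linarith

/-! ### Geodesics in `CAT(1)` spaces -/

section CATOne

variable {X : Type*} [MetricSpace X]

lemma isGeodesicPath_const (x : X) : IsGeodesicPath (fun _ => x) x x := by
  refine ⟨rfl, rfl, fun s hs t ht => ?_⟩
  simp only [dist_self, Icc_self, mem_singleton_iff] at hs ht
  simp [hs, ht]

lemma IsGeodesicPath.reverse {γ : ℝ → X} {x y : X} (h : IsGeodesicPath γ x y) :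
    IsGeodesicPath (fun s => γ (dist x y - s)) y x := by
  refine ⟨by simpa using h.2.1, by simpa [dist_comm y x] using h.1, fun s hs t ht => ?_⟩
  rw [dist_comm y x] at hs ht
  rw [h.2.2 _ ⟨by linarith [hs.2], by linarith [hs.1]⟩ _ ⟨by linarith [ht.2], by linarith [ht.1]⟩,
    abs_sub_comm]
  ring_nf

theorem IsCATOne.geodesic_unique (hX : IsCATOne X) {p q : X} (hpq : dist p q < Real.pi)
    {γ γ' : ℝ → X} (h : IsGeodesicPath γ p q) (h' : IsGeodesicPath γ' p q) :
    EqOn γ' γ (Icc 0 (dist p q)) := by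
  intro s hs
  let T : GeodesicTriangle X :=
    { vertex := ![p, q, q]
      side := ![γ, fun _ => q, fun s => γ' (dist p q - s)]
      isGeodesicPath_side := by
        intro i
        fin_cases i
        · exact h
        · exact isGeodesicPath_const q
        · exact h'.reverse }
  have hper : T.perimeter < 2 * Real.pi := by
    have : T.perimeter = dist p q + dist q q + dist q p := Fin.sum_univ_three _
    rw [this, dist_self, dist_comm q p]
    linarith
  have hd := sphericalDist_equatorPoint (dist_nonneg (x := p) (y := q)) (by linarith)
  have hs₁ := sphericalDist_equatorPoint hs.1 (by linarith [hs.2])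
  have hs₂ := sphericalDist_equatorPoint hs.2 (by linarith [hs.1])
  have hv : T.IsComparisonTriangle
      ![equatorPoint 0, equatorPoint (dist p q), equatorPoint (dist p q)] := by
    intro i
    fin_cases i
    · exact hd.trans (sub_zero _)
    · exact (sphericalDist_self _).trans (dist_self q).symm
    · exact (sphericalDist_comm _ _).trans (hd.trans ((sub_zero _).trans (dist_comm p q)))
  have hcomp := hX.comparison T hper _ hv 2 0 (dist p q - s)
    ⟨by linarith [hs.2], (sub_le_self _ hs.1).trans (dist_comm p q).le⟩ s hs
    (equatorPoint s) (equatorPoint s)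
    ⟨(sphericalDist_comm _ _).trans hs₂, (sphericalDist_comm _ _).trans (hs₁.trans (by
      change s - 0 = dist q p - (dist p q - s)
      rw [dist_comm q p]; ring))⟩
    ⟨hs₁.trans (sub_zero _), hs₂⟩
  rw [sphericalDist_self] at hcomp
  change dist (γ' (dist p q - (dist p q - s))) (γ s) ≤ 0 at hcomp
  rw [sub_sub_cancel] at hcomp
  exact dist_le_zero.1 hcomp

theorem IsCATOne.dist_midpoint_le (hX : IsCATOne X) {p q x : X}
    (hx : dist p x + dist q x < Real.pi) {γ : ℝ → X} (h : IsGeodesicPath γ p q) :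
    dist x (γ (dist p q / 2)) ≤ (dist p x + dist q x) / 2 := by
  have h₁ : dist p q ≤ dist p x + dist q x := dist_triangle_right p q x
  have h₂ : dist p x ≤ dist p q + dist q x := dist_triangle p q x
  have h₃ : dist q x ≤ dist p q + dist p x := by
    simpa [dist_comm q p] using dist_triangle q p x
  have hpx := dist_nonneg (x := p) (y := x)
  have hqx := dist_nonneg (x := q) (y := x)
  have hpq := dist_nonneg (x := p) (y := q)
  obtain ⟨σ, hσ⟩ := hX.exists_geodesic q x (by linarith)
  obtain ⟨τ, hτ⟩ := hX.exists_geodesic x p (by rw [dist_comm]; linarith)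
  obtain ⟨v, hv₀, hv₁, hvm⟩ :=
    exists_sphere_triangle (h₁.trans_lt hx) hpx hqx h₁ h₂ h₃ hx.le
  let T : GeodesicTriangle X :=
    { vertex := ![p, q, x]
      side := ![γ, σ, τ]
      isGeodesicPath_side := by
        intro i
        fin_cases i
        · exact h
        · exact hσ
        · exact hτ }
  have hper : T.perimeter < 2 * Real.pi := by
    have : T.perimeter = dist p q + dist q x + dist x p := Fin.sum_univ_three _
    rw [this, dist_comm x p]
    linarith
  have hd := sphericalDist_equatorPoint hpq (by linarith)
  have hm₁ := sphericalDist_equatorPoint (θ := 0) (φ := dist p q / 2) (by linarith) (by linarith)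
  have hm₂ := sphericalDist_equatorPoint (θ := dist p q / 2) (φ := dist p q) (by linarith)
    (by linarith)
  have hv : T.IsComparisonTriangle ![equatorPoint 0, equatorPoint (dist p q), v] := by
    intro i
    fin_cases i
    · exact hd.trans (sub_zero _)
    · exact hv₁
    · exact (sphericalDist_comm _ _).trans (hv₀.trans (dist_comm p x))
  have hcomp := hX.comparison T hper _ hv 0 1 (dist p q / 2)
    ⟨by linarith, half_le_self hpq⟩ (dist q x) ⟨hqx, le_rfl⟩ (equatorPoint (dist p q / 2)) v
    ⟨hm₁.trans (sub_zero _), hm₂⟩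
    ⟨hv₁, (sphericalDist_self _).trans (sub_self _).symm⟩
  change dist (γ (dist p q / 2)) (σ (dist q x)) ≤ _ at hcomp
  rw [hσ.2.1, dist_comm] at hcomp
  exact hcomp.trans hvm

/-! ### Arc length of continuous rectifiable curves -/

theorem continuousOn_variationOnFromTo {c : ℝ → X} {s : Set ℝ} (hc : ContinuousOn c s)
    (hbv : LocallyBoundedVariationOn c s) {a : ℝ} (ha : a ∈ s) :
    ContinuousOn (variationOnFromTo c s a) s := by
  intro x hx
  have hl := variationOnFromTo.tendsto_left ha hx hbv
    ((hc x hx).mono_left (nhdsWithin_mono _ inter_subset_left))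
  have hr := variationOnFromTo.tendsto_right ha hx hbv
    ((hc x hx).mono_left (nhdsWithin_mono _ inter_subset_left))
  rw [dist_self, sub_zero] at hl
  rw [dist_self, add_zero] at hr
  have hs : s ⊆ insert x (s ∩ Iio x ∪ s ∩ Ioi x) := by
    intro y hy
    rcases lt_trichotomy y x with h | h | h
    · exact Or.inr (Or.inl ⟨hy, h⟩)
    · exact Or.inl h
    · exact Or.inr (Or.inr ⟨hy, h⟩)
  have hlr : ContinuousWithinAt (variationOnFromTo c s a) (s ∩ Iio x ∪ s ∩ Ioi x) x :=
    ContinuousWithinAt.union hl hr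
  exact (continuousWithinAt_insert_self.2 hlr).mono hs

lemma curveLength_eq_ofReal_sub {c : ℝ → X} {a b s t : ℝ} (hbv : BoundedVariationOn c (Icc a b))
    (has : a ≤ s) (hst : s ≤ t) (htb : t ≤ b) :
    curveLength c s t = ENNReal.ofReal
      (variationOnFromTo c (Icc a b) a t - variationOnFromTo c (Icc a b) a s) := by
  have ha : a ∈ Icc a b := ⟨le_rfl, has.trans (hst.trans htb)⟩
  have hs : s ∈ Icc a b := ⟨has, hst.trans htb⟩
  have ht : t ∈ Icc a b := ⟨has.trans hst, htb⟩
  have hl := hbv.locallyBoundedVariationOn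
  rw [variationOnFromTo.sub_right hl ha ht hs, variationOnFromTo.eq_of_le _ _ hst,
    ENNReal.ofReal_toReal (hl s t hs ht), inter_eq_right.2 (Icc_subset_Icc has htb), curveLength]

lemma isAntipodalPair_iff {c : ℝ → X} {a b s t : ℝ} (hbv : BoundedVariationOn c (Icc a b))
    (has : a ≤ s) (hst : s ≤ t) (htb : t ≤ b) :
    IsAntipodalPair c a b s t ↔
      2 * (variationOnFromTo c (Icc a b) a t - variationOnFromTo c (Icc a b) a s) =
        variationOnFromTo c (Icc a b) a b := by
  have hs : s ∈ Icc a b := ⟨has, hst.trans htb⟩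
  have ht : t ∈ Icc a b := ⟨has.trans hst, htb⟩
  have ha : a ∈ Icc a b := ⟨le_rfl, has.trans (hst.trans htb)⟩
  have hm := variationOnFromTo.monotoneOn hbv.locallyBoundedVariationOn ha hs ht hst
  have h2 : (2 : ENNReal) = ENNReal.ofReal 2 := by simp
  simp only [IsAntipodalPair, has, hst, htb, true_and]
  rw [curveLength_eq_ofReal_sub hbv has hst htb, curveLength_eq_ofReal_sub hbv le_rfl ha.2 le_rfl,
    h2, ← ENNReal.ofReal_mul zero_le_two, variationOnFromTo.self, sub_zero,
    ENNReal.ofReal_eq_ofReal_iff (by linarith) (variationOnFromTo.nonneg_of_le _ _ ha.2)]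

/-- For a parameter `s` in the first half of the curve the antipodal parameter lies after `s`,
otherwise before `s`. -/
lemma exists_isAntipodalPair {c : ℝ → X} {a b s : ℝ} (hbv : BoundedVariationOn c (Icc a b))
    (hc : ContinuousOn c (Icc a b)) (hs : s ∈ Icc a b) :
    (2 * variationOnFromTo c (Icc a b) a s ≤ variationOnFromTo c (Icc a b) a b →
      ∃ t, IsAntipodalPair c a b s t) ∧
    (variationOnFromTo c (Icc a b) a b ≤ 2 * variationOnFromTo c (Icc a b) a s →
      ∃ t, IsAntipodalPair c a b t s) := by
  have ha : a ∈ Icc a b := ⟨le_rfl, hs.1.trans hs.2⟩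
  have hV := continuousOn_variationOnFromTo hc hbv.locallyBoundedVariationOn ha
  have hn := variationOnFromTo.nonneg_of_le c (Icc a b) ha.2
  have hsb := variationOnFromTo.monotoneOn hbv.locallyBoundedVariationOn ha hs
    (right_mem_Icc.2 ha.2) hs.2
  constructor
  · intro h
    obtain ⟨t, ht, e⟩ := intermediate_value_Icc hs.2 (hV.mono (Icc_subset_Icc hs.1 le_rfl))
      (show variationOnFromTo c (Icc a b) a s + variationOnFromTo c (Icc a b) a b / 2 ∈ _ from
        ⟨by linarith, by linarith⟩)
    exact ⟨t, (isAntipodalPair_iff hbv hs.1 ht.1 ht.2).2 (by rw [e]; ring)⟩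
  · intro h
    obtain ⟨t, ht, e⟩ := intermediate_value_Icc hs.1 (hV.mono (Icc_subset_Icc le_rfl hs.2))
      (show variationOnFromTo c (Icc a b) a s - variationOnFromTo c (Icc a b) a b / 2 ∈ _ from
        ⟨by rw [variationOnFromTo.self]; linarith, by linarith⟩)
    exact ⟨t, (isAntipodalPair_iff hbv ht.1 ht.2 hs.2).2 (by rw [e]; ring)⟩

lemma dist_le_variationOnFromTo_sub {c : ℝ → X} {a b s t : ℝ}
    (hbv : BoundedVariationOn c (Icc a b)) (has : a ≤ s) (hst : s ≤ t) (htb : t ≤ b) :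
    dist (c s) (c t) ≤
      variationOnFromTo c (Icc a b) a t - variationOnFromTo c (Icc a b) a s := by
  have hm := variationOnFromTo.monotoneOn hbv.locallyBoundedVariationOn
    ⟨le_rfl, has.trans (hst.trans htb)⟩ ⟨has, hst.trans htb⟩ ⟨has.trans hst, htb⟩ hst
  have h := eVariationOn.edist_le c (left_mem_Icc.2 hst) (right_mem_Icc.2 hst)
  have e := curveLength_eq_ofReal_sub hbv has hst htb
  rw [curveLength] at e
  rwa [e, edist_dist, ENNReal.ofReal_le_ofReal_iff (by linarith)] at h

/-- Each of the two arcs between antipodal points has half the total length, which bounds the sum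
of the distances from any point of the curve to the two antipodal points. -/
lemma dist_add_dist_le_of_isAntipodalPair {c : ℝ → X} {a b s t u : ℝ}
    (hbv : BoundedVariationOn c (Icc a b)) (hclosed : c a = c b)
    (h : IsAntipodalPair c a b s t) (hu : u ∈ Icc a b) :
    dist (c s) (c u) + dist (c t) (c u) ≤ variationOnFromTo c (Icc a b) a b / 2 := by
  have e := (isAntipodalPair_iff hbv h.1 h.2.1 h.2.2.1).1 h
  obtain ⟨has, hst, htb, -⟩ := h
  have hself := variationOnFromTo.self c (Icc a b) a
  have h₁ := dist_le_variationOnFromTo_sub hbv le_rfl has (hst.trans htb)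
  have h₂ := dist_le_variationOnFromTo_sub hbv (has.trans hst) htb le_rfl
  rcases le_total u s with hus | hus
  · have h₃ := dist_le_variationOnFromTo_sub hbv hu.1 hus (hst.trans htb)
    have h₄ := dist_le_variationOnFromTo_sub hbv le_rfl hu.1 hu.2
    have h₅ := dist_triangle (c t) (c b) (c u)
    rw [← hclosed] at h₂ h₅
    rw [dist_comm] at h₃
    linarith
  rcases le_total u t with hut | hut
  · have h₃ := dist_le_variationOnFromTo_sub hbv has hus hu.2
    have h₄ := dist_le_variationOnFromTo_sub hbv hu.1 hut htb
    rw [dist_comm] at h₄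
    linarith
  · have h₃ := dist_le_variationOnFromTo_sub hbv (has.trans hst) hut hu.2
    have h₄ := dist_le_variationOnFromTo_sub hbv hu.1 hu.2 le_rfl
    have h₅ := dist_triangle (c s) (c a) (c u)
    rw [dist_comm (c s) (c a), hclosed] at h₅
    rw [hclosed] at h₁
    rw [dist_comm (c u)] at h₄
    linarith

end CATOne

/-! ### Closed curves of length less than `2π` -/

theorem mainTheorem12 {X : Type*} [MetricSpace X] (hX : IsCATOne X)
    (c : ℝ → X) (a b : ℝ) (hc : IsClosedCurve c a b)
    (hlen : curveLength c a b < ENNReal.ofReal (2 * Real.pi)) :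
    (curveLength c a b).toReal / 4 < Real.pi / 2 ∧
    (∃ (m : X) (r : ℝ), r ≤ (curveLength c a b).toReal / 4 ∧
      c '' Set.Icc a b ⊆ Metric.closedBall m r) ∧
    (∃ t, IsAntipodalPair c a b a t) ∧
    (∀ s ∈ Set.Icc a b, ∃ t, IsAntipodalPair c a b s t ∨ IsAntipodalPair c a b t s) ∧
    (∀ s t, IsAntipodalPair c a b s t →
      ∃ γ : ℝ → X, IsGeodesicPath γ (c s) (c t) ∧
        (∀ γ' : ℝ → X, IsGeodesicPath γ' (c s) (c t) →
          Set.EqOn γ' γ (Set.Icc 0 (dist (c s) (c t)))) ∧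
        c '' Set.Icc a b ⊆
          Metric.closedBall (γ (dist (c s) (c t) / 2)) ((curveLength c a b).toReal / 4)) := by
  obtain ⟨hab, hcont, hclosed⟩ := hc
  have hbv : BoundedVariationOn c (Icc a b) := hlen.ne_top
  have hn := variationOnFromTo.nonneg_of_le c (Icc a b) hab
  have hV : (curveLength c a b).toReal = variationOnFromTo c (Icc a b) a b := by
    rw [curveLength_eq_ofReal_sub hbv le_rfl hab le_rfl, variationOnFromTo.self, sub_zero,
      ENNReal.toReal_ofReal hn]
  have hlt : variationOnFromTo c (Icc a b) a b < 2 * Real.pi := by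
    rw [← hV]
    exact (ENNReal.lt_ofReal_iff_toReal_lt hbv).1 hlen
  rw [hV]
  have hball : ∀ s t, IsAntipodalPair c a b s t →
      ∃ γ : ℝ → X, IsGeodesicPath γ (c s) (c t) ∧
        (∀ γ' : ℝ → X, IsGeodesicPath γ' (c s) (c t) →
          Set.EqOn γ' γ (Set.Icc 0 (dist (c s) (c t)))) ∧
        c '' Set.Icc a b ⊆ Metric.closedBall (γ (dist (c s) (c t) / 2))
          (variationOnFromTo c (Icc a b) a b / 4) := by
    intro s t h
    have hd : dist (c s) (c t) < Real.pi := by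
      have := dist_add_dist_le_of_isAntipodalPair hbv hclosed h ⟨h.1.trans h.2.1, h.2.2.1⟩
      rw [dist_self] at this
      linarith
    obtain ⟨γ, hγ⟩ := hX.exists_geodesic _ _ hd
    refine ⟨γ, hγ, fun γ' hγ' => hX.geodesic_unique hd hγ hγ', ?_⟩
    rintro _ ⟨u, hu, rfl⟩
    have hsum := dist_add_dist_le_of_isAntipodalPair hbv hclosed h hu
    have := hX.dist_midpoint_le (x := c u) (by linarith) hγ
    rw [Metric.mem_closedBall]
    linarith
  have hanti : ∃ t, IsAntipodalPair c a b a t :=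
    (exists_isAntipodalPair hbv hcont (left_mem_Icc.2 hab)).1
      (by rw [variationOnFromTo.self]; linarith)
  refine ⟨by linarith, ?_, hanti, fun s hs => ?_, hball⟩
  · obtain ⟨t, ht⟩ := hanti
    obtain ⟨γ, -, -, hsub⟩ := hball a t ht
    exact ⟨_, _, le_rfl, hsub⟩
  · have h := exists_isAntipodalPair hbv hcont hs
    rcases le_total (2 * variationOnFromTo c (Icc a b) a s) (variationOnFromTo c (Icc a b) a b)
      with hle | hle
    · obtain ⟨t, ht⟩ := h.1 hle
      exact ⟨t, Or.inl ht⟩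
    · obtain ⟨t, ht⟩ := h.2 hle
      exact ⟨t, Or.inr ht⟩
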